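/- Let $\mathbb C_+$ be the open upper half-plane, let $\mathscr S_n(\mathbb C_+)$ be the set of analytic functions $B:\mathbb C_+\to\mathbb C^{n\times n}$ with $\|B(w)\|\le 1$ (operator norm) for all $w$, and let $\mathscr U_n$ be the set of unitary $n\times n$ matrices. For $F\in\mathscr S_n(\mathbb C_+)$ with $I-F(w)$ invertible for all $w\in\mathbb C_+$, the Clark measure $\mu^F$ is the unique nonnegative $n\times n$ matrix-valued Borel measure on $\mathbb R$, finite on bounded sets and with $\int \frac{\mu^F(dt)}{1+t^2}$ convergent, such that for some constant positive semidefinite matrix $c$ $$\operatorname{Re}\big[(I-F(w))^{-1}(I+F(w))\big]=c\,\operatorname{Im}w+\int_{-\infty}^{\infty}\operatorname{Re}\Big(\frac1{i\pi}\,\frac1{t-w}\Big)\,\mu^F(dt)\qquad(w\in\mathbb C_+),$$ where $\operatorname{Re}M=\tfrac12(M+M^*)$ for a matrix $M$. **Theorem.** Let $B_1,B_2\in\mathscr S_n(\mathbb C_+)$ and $R,Q\in\mathscr U_n$ be such that $B_1(w)=R\,B_2(w)\,Q$ for all $w\in\mathbb C_+$. Let $\alpha\in\mathscr U_n$ be such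 that $I-B_1(w)\alpha^*$ is invertible for all $w\in\mathbb C_+$. Then the Clark measures $\mu^{B_1\alpha^*}$ and $\mu^{B_2(Q\alpha^*R)}$ exist and are unique, and for all $s\in\mathbb R$ $$\mu^{B_1\alpha^*}(\{s\})=R\,\mu^{B_2(Q\alpha^*R)}(\{s\})\,R^*.$$ -/

import Mathlib

open scoped Matrix ComplexOrder

noncomputable section

/-- The Schur class `S_n(X)`: the closed unit ball of the bounded analytic `n × n` matrix-valued
functions on `X`, that is, the analytic functions whose values are contractions of `ℂⁿ` with its
Euclidean norm. Only the values on `X` matter. -/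
structure IsSchur {n : ℕ} (X : Set ℂ) (B : ℂ → Matrix (Fin n) (Fin n) ℂ) : Prop where
  analytic : ∀ i j, DifferentiableOn ℂ (fun w => B w i j) X
  contractive : ∀ w ∈ X, ‖Matrix.toEuclideanCLM (𝕜 := ℂ) (B w)‖ ≤ 1

/-- The open upper half-plane `ℂ₊`. -/
def upperHalf : Set ℂ := {w | 0 < w.im}

/-- The quadratic form `Re ⟨M x, x⟩` of a matrix `M`; it equals `⟨M x, x⟩` when `M` is Hermitian,
and `⟨(Re M) x, x⟩` with `Re M = (M + M*) / 2` in general. -/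
def qform {n : ℕ} (M : Matrix (Fin n) (Fin n) ℂ) (x : Fin n → ℂ) : ℝ :=
  (star x ⬝ᵥ (M *ᵥ x)).re

/-- A nonnegative `n × n` matrix-valued Borel measure on the real line, finite on bounded sets
(in general it is not finite on `ℝ`): a countably additive function on the bounded Borel sets with
positive semidefinite values. It is given the value `0` on all other sets, so that two such
measures are equal as soon as they agree on the bounded Borel sets. -/
structure MatrixMeasure (n : ℕ) where
  toFun : Set ℝ → Matrix (Fin n) (Fin n) ℂ
  posSemidef' : ∀ Ω, MeasurableSet Ω → Bornology.IsBounded Ω → (toFun Ω).PosSemidef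
  hasSum' : ∀ f : ℕ → Set ℝ, (∀ k, MeasurableSet (f k)) → Pairwise (Function.onFun Disjoint f) →
    Bornology.IsBounded (⋃ k, f k) → HasSum (fun k => toFun (f k)) (toFun (⋃ k, f k))
  eq_zero' : ∀ Ω, ¬ (MeasurableSet Ω ∧ Bornology.IsBounded Ω) → toFun Ω = 0

namespace MatrixMeasure

variable {n : ℕ}

instance : CoeFun (MatrixMeasure n) (fun _ => Set ℝ → Matrix (Fin n) (Fin n) ℂ) := ⟨toFun⟩

instance : Zero (MatrixMeasure n) :=
  ⟨{ toFun := fun _ => 0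
     posSemidef' := fun _ _ _ => Matrix.PosSemidef.zero
     hasSum' := fun _ _ _ _ => hasSum_zero
     eq_zero' := fun _ _ => rfl }⟩

theorem qform_hasSum {f : ℕ → Matrix (Fin n) (Fin n) ℂ} {M : Matrix (Fin n) (Fin n) ℂ}
    (h : HasSum f M) (x : Fin n → ℂ) : HasSum (fun k => qform (f k) x) (qform M x) := by
  let q : Matrix (Fin n) (Fin n) ℂ →+ ℝ :=
    { toFun := fun A => qform A x
      map_zero' := by simp [qform]
      map_add' := fun A B => by simp [qform, Matrix.add_mulVec, dotProduct_add] }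
  have hq : Continuous q := by
    change Continuous fun A : Matrix (Fin n) (Fin n) ℂ => (star x ⬝ᵥ (A *ᵥ x)).re
    fun_prop
  exact h.map q hq

/-- The bounded shells `{t : k ≤ |t| < k + 1}`, which partition `ℝ`. -/
def shell (k : ℕ) : Set ℝ := {t | ⌊|t|⌋₊ = k}

theorem measurableSet_shell (k : ℕ) : MeasurableSet (shell k) :=
  (Nat.measurable_floor.comp measurable_norm) (measurableSet_singleton k)

theorem isBounded_shell (k : ℕ) : Bornology.IsBounded (shell k) := by
  refine (Metric.isBounded_closedBall (x := (0 : ℝ)) (r := k + 1)).subset fun t ht => ?_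
  have h := Nat.lt_floor_add_one |t|
  have ht' : ⌊|t|⌋₊ = k := ht
  rw [ht'] at h
  simpa using h.le

theorem disjoint_shell : Pairwise (Function.onFun Disjoint shell) := by
  intro i j hij
  refine Set.disjoint_left.2 fun t hi hj => hij ?_
  exact (show ⌊|t|⌋₊ = i from hi).symm.trans hj

theorem iUnion_inter_shell (Ω : Set ℝ) : ⋃ k, Ω ∩ shell k = Ω := by
  ext t
  simp [shell]

theorem empty (μ : MatrixMeasure n) : μ ∅ = 0 := by
  have h := μ.hasSum' (fun _ => ∅) (fun _ => MeasurableSet.empty)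
    (fun _ _ _ => disjoint_bot_left) (by simp)
  simpa using h.summable.tendsto_atTop_zero

theorem qform_nonneg (μ : MatrixMeasure n) (x : Fin n → ℂ) {Ω : Set ℝ} (hm : MeasurableSet Ω)
    (hb : Bornology.IsBounded Ω) : 0 ≤ qform (μ Ω) x :=
  (μ.posSemidef' Ω hm hb).re_dotProduct_nonneg x

/-- The restriction of the scalar measure `⟨μ(·) x, x⟩` to a bounded shell. -/
def scalarShell (μ : MatrixMeasure n) (x : Fin n → ℂ) (k : ℕ) : MeasureTheory.Measure ℝ :=
  MeasureTheory.Measure.ofMeasurable (fun Ω _ => ENNReal.ofReal (qform (μ (Ω ∩ shell k)) x))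
    (by simp [μ.empty, qform])
    (by
      intro f hf hd
      have hm : ∀ i, MeasurableSet (f i ∩ shell k) := fun i => (hf i).inter (measurableSet_shell k)
      have hb : ∀ Ω : Set ℝ, Bornology.IsBounded (Ω ∩ shell k) := fun Ω =>
        (isBounded_shell k).subset Set.inter_subset_right
      have h := qform_hasSum (μ.hasSum' (fun i => f i ∩ shell k) hm
        (fun i j hij => (hd hij).mono Set.inter_subset_left Set.inter_subset_left)
        (by rw [← Set.iUnion_inter]; exact hb _)) x
      rw [← Set.iUnion_inter] at h
      rw [← h.tsum_eq]
      exact ENNReal.ofReal_tsum_of_nonneg (fun i => μ.qform_nonneg x (hm i) (hb _)) h.summable)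

/-- The scalar nonnegative Borel measure `Ω ↦ ⟨μ(Ω) x, x⟩` on `ℝ`. -/
def scalar (μ : MatrixMeasure n) (x : Fin n → ℂ) : MeasureTheory.Measure ℝ :=
  MeasureTheory.Measure.sum (μ.scalarShell x)

theorem scalar_apply (μ : MatrixMeasure n) (x : Fin n → ℂ) {Ω : Set ℝ} (hm : MeasurableSet Ω)
    (hb : Bornology.IsBounded Ω) : μ.scalar x Ω = ENNReal.ofReal (qform (μ Ω) x) := by
  have hm' : ∀ k, MeasurableSet (Ω ∩ shell k) := fun k => hm.inter (measurableSet_shell k)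
  have hb' : ∀ k, Bornology.IsBounded (Ω ∩ shell k) := fun k => hb.subset Set.inter_subset_left
  have h := qform_hasSum (μ.hasSum' (fun k => Ω ∩ shell k) hm'
    (fun i j hij => (disjoint_shell hij).mono Set.inter_subset_right Set.inter_subset_right)
    (by rw [iUnion_inter_shell]; exact hb)) x
  rw [iUnion_inter_shell] at h
  rw [scalar, MeasureTheory.Measure.sum_apply _ hm, ← h.tsum_eq,
    ENNReal.ofReal_tsum_of_nonneg (fun k => μ.qform_nonneg x (hm' k) (hb' k)) h.summable]
  exact tsum_congr fun k => MeasureTheory.Measure.ofMeasurable_apply Ω hm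

end MatrixMeasure

/-- The Nevanlinna function `H = (I - F)⁻¹ (I + F)` of a matrix-valued function `F`. -/
def nevanlinna {n : ℕ} (F : ℂ → Matrix (Fin n) (Fin n) ℂ) (w : ℂ) : Matrix (Fin n) (Fin n) ℂ :=
  (1 - F w)⁻¹ * (1 + F w)

/-- `μ` represents `F` in the Nevanlinna representation
`Re H(w) = c Im w + ∫ Re ((1 / (iπ)) (1 / (t - w))) μ(dt)` on `ℂ₊`, with a constant positive
semidefinite matrix `c` and `∫ μ(dt) / (1 + t²)` convergent. The identity of Hermitian matrices is
written as the equality of their quadratic forms. -/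
def IsClarkMeasure {n : ℕ} (F : ℂ → Matrix (Fin n) (Fin n) ℂ) (μ : MatrixMeasure n) : Prop :=
  ∃ c : Matrix (Fin n) (Fin n) ℂ, c.PosSemidef ∧ ∀ x : Fin n → ℂ,
    MeasureTheory.Integrable (fun t : ℝ => (1 + t ^ 2)⁻¹) (μ.scalar x) ∧
    ∀ w ∈ upperHalf, qform (nevanlinna F w) x =
      qform c x * w.im +
        ∫ t : ℝ, ((1 / (Complex.I * Real.pi)) * (1 / ((t : ℂ) - w))).re ∂(μ.scalar x)

open Classical in
/-- The Clark measure `μ^F`: the matrix-valued measure that represents `F`. -/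
def clarkMeasure {n : ℕ} (F : ℂ → Matrix (Fin n) (Fin n) ℂ) : MatrixMeasure n :=
  if h : ∃ μ, IsClarkMeasure F μ then h.choose else 0

end

/-! Since `B₂ = R* B₁ Q*` on the half-plane, `B₂ (Q α* R) = R* (B₁ α*) R`. Conjugation by a unitary
passes to the Nevanlinna function, so if `μ` with linear coefficient `c` represents `B₁ α*`, then
`R* μ R` with `R* c R` represents the second function (`IsClarkMeasure.conj`). Uniqueness makes `R*
μ R` its Clark measure, and evaluating at `{s}` gives the formula. The work lies in existence and
uniqueness.

Uniqueness (`IsClarkMeasure.unique`): the scalar measures `⟨μ x, x⟩` are recovered from their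
Poisson integrals by Stieltjes inversion, and quadratic forms determine positive semidefinite
matrices.

Existence (`exists_isClarkMeasure`): `⟨H x, x⟩` has nonnegative real part. Moved to the disk, it is
the Poisson integral of a weak limit of its real part on circles of radius `r → 1`. One ultrafilter
of radii serves every `x`, so quadratic dependence on `x` survives the limit, and finitely many
vectors suffice to assemble a matrix-valued measure. Back on the line, the mass at the boundary
point `1` becomes `c` and the rest becomes `μ`. -/

noncomputable section

open MeasureTheory Filter Topology

/-! ### Poisson kernel of the half-plane and Stieltjes inversion. -/

/-- The Poisson kernel of the upper half-plane. -/
def linePoisson (y s : ℝ) : ℝ := Real.pi⁻¹ * (y / (s ^ 2 + y ^ 2))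

theorem linePoisson_nonneg {y : ℝ} (hy : 0 < y) (s : ℝ) : 0 ≤ linePoisson y s := by
  unfold linePoisson
  have := Real.pi_pos
  positivity

theorem continuous_linePoisson {y : ℝ} (hy : 0 < y) : Continuous (linePoisson y) := by
  unfold linePoisson
  refine continuous_const.mul (continuous_const.div (by fun_prop) fun s => ?_)
  positivity

theorem linePoisson_eq_re (t : ℝ) (w : ℂ) :
    ((1 / (Complex.I * Real.pi)) * (1 / ((t : ℂ) - w))).re = linePoisson w.im (t - w.re) := by
  have h : (1 / (Complex.I * Real.pi)) * (1 / ((t : ℂ) - w)) =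
      ((Real.pi⁻¹ : ℝ) : ℂ) * (-Complex.I * ((t : ℂ) - w)⁻¹) := by
    rw [one_div, one_div, mul_inv, Complex.inv_I, Complex.ofReal_inv]
    ring
  rw [h, Complex.re_ofReal_mul, linePoisson]
  congr 1
  simp [Complex.mul_re, Complex.inv_im, Complex.normSq_apply]
  ring_nf

/-- The substitution `s = t + y v` moves `y` from the kernel into the argument of `g`, so that `y →
0` becomes a dominated limit. No integrability is needed. -/
theorem integral_mul_linePoisson (g : ℝ → ℝ) {y : ℝ} (hy : 0 < y) (t : ℝ) :
    ∫ s, g s * linePoisson y (t - s) =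
      ∫ v, g (t + y * v) * (Real.pi⁻¹ * (1 + v ^ 2)⁻¹) := by
  rw [← integral_add_left_eq_self (fun s => g s * linePoisson y (t - s)) t]
  have h := Measure.integral_comp_mul_left
    (fun s => g (t + s) * linePoisson y (t - (t + s))) y
  rw [abs_of_pos (inv_pos.2 hy), smul_eq_mul] at h
  rw [← (mul_inv_cancel_left₀ hy.ne' (∫ s, g (t + s) * linePoisson y (t - (t + s)))), ← h,
    ← integral_const_mul]
  refine integral_congr_ae (.of_forall fun v => ?_)
  simp only [linePoisson]
  have : (0 : ℝ) < 1 + v ^ 2 := by positivity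
  have h2 : (t - (t + y * v)) ^ 2 + y ^ 2 = y ^ 2 * (1 + v ^ 2) := by ring
  rw [h2]
  field_simp

theorem integral_linePoisson {y : ℝ} (hy : 0 < y) (t : ℝ) :
    ∫ s, linePoisson y (t - s) = 1 := by
  have h := integral_mul_linePoisson (fun _ => 1) hy t
  simp only [one_mul] at h
  rw [h, integral_const_mul, integral_univ_inv_one_add_sq, inv_mul_cancel₀ Real.pi_ne_zero]

theorem integrable_linePoisson_sub {y : ℝ} (hy : 0 < y) (t : ℝ) :
    Integrable fun s => linePoisson y (t - s) := by
  -- A non-integrable function has integral `0` by convention, but this integral is `1`.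
  by_contra h
  have h1 := integral_linePoisson hy t
  rw [integral_undef h] at h1
  exact zero_ne_one h1

theorem tendsto_integral_mul_linePoisson {g : ℝ → ℝ} (hg : Continuous g) {M : ℝ}
    (hM : ∀ s, |g s| ≤ M) (t : ℝ) :
    Tendsto (fun y => ∫ s, g s * linePoisson y (t - s)) (𝓝[>] 0) (𝓝 (g t)) := by
  have hw : Integrable fun v : ℝ => Real.pi⁻¹ * (1 + v ^ 2)⁻¹ :=
    integrable_inv_one_add_sq.const_mul _
  have h : Tendsto (fun y => ∫ v, g (t + y * v) * (Real.pi⁻¹ * (1 + v ^ 2)⁻¹)) (𝓝[>] 0)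
      (𝓝 (∫ v, g t * (Real.pi⁻¹ * (1 + v ^ 2)⁻¹))) := by
    refine tendsto_integral_filter_of_dominated_convergence
      (fun v => M * (Real.pi⁻¹ * (1 + v ^ 2)⁻¹)) (.of_forall fun y => ?_)
      (.of_forall fun y => .of_forall fun v => ?_) (hw.const_mul M) (.of_forall fun v => ?_)
    · exact (Continuous.aestronglyMeasurable (by fun_prop)).mul hw.aestronglyMeasurable
    · have h0 : 0 ≤ Real.pi⁻¹ * (1 + v ^ 2)⁻¹ := by have := Real.pi_pos; positivity
      rw [Real.norm_eq_abs, abs_mul, abs_of_nonneg h0]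
      exact mul_le_mul_of_nonneg_right (hM _) h0
    · refine Tendsto.mul_const _ ((hg.tendsto t).comp ?_)
      have : Tendsto (fun y : ℝ => t + y * v) (𝓝 0) (𝓝 (t + 0 * v)) :=
        Continuous.tendsto (by fun_prop) 0
      simpa using this.mono_left nhdsWithin_le_nhds
  rw [integral_const_mul, integral_const_mul, integral_univ_inv_one_add_sq,
    inv_mul_cancel₀ Real.pi_ne_zero, mul_one] at h
  refine h.congr' ?_
  filter_upwards [self_mem_nhdsWithin] with y hy
  exact (integral_mul_linePoisson g hy t).symm

/-- Combines `t² ≤ 2 s² + 2 (t - s)²` with `(t - s)² P ≤ y / π`, where `P` is the kernel. It is the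
source of all decay estimates in `t`. -/
theorem one_add_sq_mul_linePoisson_le {K s y : ℝ} (hy : 0 < y) (hs : |s| ≤ K) (t : ℝ) :
    (1 + t ^ 2) * linePoisson y (t - s) ≤
      (1 + 2 * K ^ 2) * linePoisson y (t - s) + 2 * Real.pi⁻¹ * y := by
  have hs2 : s ^ 2 ≤ K ^ 2 := sq_le_sq' (by linarith [neg_abs_le s]) ((le_abs_self s).trans hs)
  have h1 : 1 + t ^ 2 ≤ 1 + 2 * K ^ 2 + 2 * (t - s) ^ 2 := by nlinarith [sq_nonneg (t - 2 * s)]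
  have h2 : (t - s) ^ 2 * linePoisson y (t - s) ≤ Real.pi⁻¹ * y := by
    have hpi := inv_pos.2 Real.pi_pos
    rw [linePoisson, mul_left_comm]
    refine mul_le_mul_of_nonneg_left ?_ hpi.le
    rw [mul_div_assoc', div_le_iff₀ (by positivity)]
    nlinarith [pow_pos hy 3]
  nlinarith [mul_le_mul_of_nonneg_right h1 (linePoisson_nonneg hy (t - s))]

theorem exists_linePoisson_le (K : ℝ) {y : ℝ} (hy : 0 < y) :
    ∃ C : ℝ, ∀ s, |s| ≤ K → ∀ t, linePoisson y (t - s) ≤ C * (1 + t ^ 2)⁻¹ := by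
  refine ⟨(1 + 2 * K ^ 2) * (Real.pi⁻¹ * y⁻¹) + 2 * Real.pi⁻¹ * y, fun s hs t => ?_⟩
  have ht : (0 : ℝ) < 1 + t ^ 2 := by positivity
  rw [← div_eq_mul_inv, le_div_iff₀ ht, mul_comm]
  refine (one_add_sq_mul_linePoisson_le hy hs t).trans ?_
  gcongr
  rw [linePoisson]
  have := Real.pi_pos
  gcongr
  rw [div_le_iff₀ (by positivity), inv_mul_eq_div, le_div_iff₀ hy]
  nlinarith [sq_nonneg (t - s)]

/-- Serves as dominating function when `y → 0`, so `C` must not depend on `y`. The kernel itself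
peaks like `1 / y`; after integration against `g` the peak costs only `sup |g|` times total mass
`1`, and the tail only `∫ |g|`. -/
theorem exists_bound_integral_mul_linePoisson {g : ℝ → ℝ} (hg : Continuous g)
    (hc : HasCompactSupport g) :
    ∃ C : ℝ, ∀ y, 0 < y → y ≤ 1 → ∀ t,
      |∫ s, g s * linePoisson y (t - s)| ≤ C * (1 + t ^ 2)⁻¹ := by
  obtain ⟨M, hM⟩ := hc.exists_bound_of_continuous hg
  obtain ⟨K, hK⟩ := hc.isBounded.exists_norm_le
  have hgi : Integrable g := hg.integrable_of_hasCompactSupport hc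
  refine ⟨(1 + 2 * K ^ 2) * M + 2 * Real.pi⁻¹ * ∫ s, |g s|, fun y hy hy1 t => ?_⟩
  have ht : (0 : ℝ) < 1 + t ^ 2 := by positivity
  rw [← div_eq_mul_inv, le_div_iff₀ ht]
  have hP := integrable_linePoisson_sub hy t
  have hpi := inv_pos.2 Real.pi_pos
  have hM0 : 0 ≤ M := (norm_nonneg _).trans (hM 0)
  calc |∫ s, g s * linePoisson y (t - s)| * (1 + t ^ 2)
      ≤ (∫ s, |g s| * linePoisson y (t - s)) * (1 + t ^ 2) := by
        refine mul_le_mul_of_nonneg_right (abs_integral_le_integral_abs.trans_eq ?_) ht.le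
        refine integral_congr_ae (.of_forall fun s => ?_)
        simp [abs_mul, abs_of_nonneg (linePoisson_nonneg hy (t - s))]
    _ = ∫ s, |g s| * ((1 + t ^ 2) * linePoisson y (t - s)) := by
        rw [← integral_mul_const]
        exact integral_congr_ae (.of_forall fun s => by ring)
    _ ≤ ∫ s, ((1 + 2 * K ^ 2) * M * linePoisson y (t - s) + 2 * Real.pi⁻¹ * |g s|) := by
        refine integral_mono_of_nonneg (.of_forall fun s => ?_)
          ((hP.const_mul _).add (hgi.abs.const_mul _)) (.of_forall fun s => ?_)
        · have := linePoisson_nonneg hy (t - s)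
          dsimp only [Pi.zero_apply]
          positivity
        · by_cases hs : s ∈ tsupport g
          · have h1 := mul_le_mul_of_nonneg_left
              (one_add_sq_mul_linePoisson_le hy (hK s hs) t) (abs_nonneg (g s))
            have h2 : |g s| * ((1 + 2 * K ^ 2) * linePoisson y (t - s)) ≤
                M * ((1 + 2 * K ^ 2) * linePoisson y (t - s)) :=
              mul_le_mul_of_nonneg_right (hM s)
                (mul_nonneg (by positivity) (linePoisson_nonneg hy _))
            have h3 : |g s| * (2 * Real.pi⁻¹ * y) ≤ |g s| * (2 * Real.pi⁻¹ * 1) := by gcongr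
            dsimp only
            nlinarith
          · dsimp only
            rw [image_eq_zero_of_notMem_tsupport hs]
            have := linePoisson_nonneg hy (t - s)
            simp only [abs_zero, zero_mul, mul_zero, add_zero]
            positivity
    _ = _ := by
        rw [integral_add (hP.const_mul _) (hgi.abs.const_mul _), integral_const_mul,
          integral_const_mul, integral_linePoisson hy, mul_one]

/-- **Stieltjes inversion formula.** -/
theorem tendsto_integral_mul_poisson {μ : Measure ℝ} [IsLocallyFiniteMeasure μ]
    (hμ : Integrable (fun t : ℝ => (1 + t ^ 2)⁻¹) μ) (c : ℝ) {g : ℝ → ℝ} (hg : Continuous g)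
    (hc : HasCompactSupport g) :
    Tendsto (fun y => ∫ s, g s * (c * y + ∫ t, linePoisson y (t - s) ∂μ)) (𝓝[>] 0)
      (𝓝 (∫ t, g t ∂μ)) := by
  obtain ⟨M, hM⟩ := hc.exists_bound_of_continuous hg
  obtain ⟨K, hK⟩ := hc.isBounded.exists_norm_le
  have hgi : Integrable g := hg.integrable_of_hasCompactSupport hc
  obtain ⟨C, hC⟩ := exists_bound_integral_mul_linePoisson hg hc
  have hprod : ∀ y, 0 < y →
      Integrable (Function.uncurry fun s t => g s * linePoisson y (t - s)) (volume.prod μ) := by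
    intro y hy
    obtain ⟨C', hC'⟩ := exists_linePoisson_le K hy
    refine Integrable.mono' (hgi.norm.mul_prod (hμ.const_mul C')) ?_
      (.of_forall fun ⟨s, t⟩ => ?_)
    · refine Continuous.aestronglyMeasurable ?_
      exact (hg.comp continuous_fst).mul ((continuous_linePoisson hy).comp (by fun_prop))
    · simp only [Function.uncurry_apply_pair, norm_mul]
      by_cases hs : s ∈ tsupport g
      · refine mul_le_mul_of_nonneg_left ?_ (norm_nonneg _)
        rw [Real.norm_eq_abs, abs_of_nonneg (linePoisson_nonneg hy _)]
        exact hC' s (hK s hs) t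
      · simp [image_eq_zero_of_notMem_tsupport hs]
  -- Fubini transfers the Poisson smoothing from `μ` to `g`; the linear term leaves `c y ∫ g`, which
  -- vanishes as `y → 0`.
  have key : ∀ y, 0 < y → ∫ s, g s * (c * y + ∫ t, linePoisson y (t - s) ∂μ) =
      (c * y * ∫ s, g s) + ∫ t, (∫ s, g s * linePoisson y (t - s)) ∂μ := by
    intro y hy
    rw [← integral_integral_swap (hprod y hy), ← integral_const_mul, ← integral_add]
    · refine integral_congr_ae (.of_forall fun s => ?_)
      simp only [integral_const_mul]
      ring
    · exact hgi.const_mul _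
    · exact (hprod y hy).integral_prod_left
  have h1 : Tendsto (fun y => ∫ t, (∫ s, g s * linePoisson y (t - s)) ∂μ) (𝓝[>] 0)
      (𝓝 (∫ t, g t ∂μ)) := by
    refine tendsto_integral_filter_of_dominated_convergence (fun t => C * (1 + t ^ 2)⁻¹) ?_ ?_
      (hμ.const_mul C) (.of_forall fun t => tendsto_integral_mul_linePoisson hg hM t)
    · filter_upwards [self_mem_nhdsWithin] with y hy
      exact (hprod y hy).integral_prod_right.aestronglyMeasurable
    · filter_upwards [Ioc_mem_nhdsGT (zero_lt_one (α := ℝ))] with y hy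
      exact .of_forall fun t => hC y hy.1 hy.2 t
  have h2 : Tendsto (fun y : ℝ => c * y * ∫ s, g s) (𝓝[>] 0) (𝓝 0) := by
    have : Tendsto (fun y : ℝ => c * y * ∫ s, g s) (𝓝 0) (𝓝 (c * 0 * ∫ s, g s)) :=
      Continuous.tendsto (by fun_prop) 0
    simpa using this.mono_left nhdsWithin_le_nhds
  have h := h2.add h1
  rw [zero_add] at h
  refine h.congr' ?_
  filter_upwards [self_mem_nhdsWithin] with y hy
  exact (key y hy).symm

/-- Stieltjes inversion recovers the integrals of compactly supported test functions. It does not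
see the linear terms, so `c = d` need not be known. -/
theorem measure_eq_of_poisson_eq {μ ν : Measure ℝ} [IsLocallyFiniteMeasure μ]
    [IsLocallyFiniteMeasure ν] (hμ : Integrable (fun t : ℝ => (1 + t ^ 2)⁻¹) μ)
    (hν : Integrable (fun t : ℝ => (1 + t ^ 2)⁻¹) ν) {c d : ℝ}
    (h : ∀ y, 0 < y → ∀ s, c * y + ∫ t, linePoisson y (t - s) ∂μ =
      d * y + ∫ t, linePoisson y (t - s) ∂ν) : μ = ν := by
  refine Measure.ext_of_integral_eq_on_compactlySupported fun g => ?_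
  refine tendsto_nhds_unique (tendsto_integral_mul_poisson hμ c g.continuous g.hasCompactSupport) ?_
  refine (tendsto_integral_mul_poisson hν d g.continuous g.hasCompactSupport).congr' ?_
  filter_upwards [self_mem_nhdsWithin] with y hy
  exact integral_congr_ae (.of_forall fun s => congrArg (g s * ·) (h y hy s).symm)

/-! ### Uniqueness of the representing measure. -/

namespace MatrixMeasure

variable {n : ℕ}

theorem ext_of_forall {μ ν : MatrixMeasure n}
    (h : ∀ Ω, MeasurableSet Ω → Bornology.IsBounded Ω → μ Ω = ν Ω) : μ = ν := by
  have : μ.toFun = ν.toFun := by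
    ext1 Ω
    by_cases hΩ : MeasurableSet Ω ∧ Bornology.IsBounded Ω
    · exact h Ω hΩ.1 hΩ.2
    · rw [μ.eq_zero' Ω hΩ, ν.eq_zero' Ω hΩ]
  cases μ
  cases ν
  congr

instance (μ : MatrixMeasure n) (x : Fin n → ℂ) : IsLocallyFiniteMeasure (μ.scalar x) := by
  refine ⟨fun t => ⟨Metric.ball t 1, Metric.ball_mem_nhds t one_pos, ?_⟩⟩
  rw [scalar_apply _ _ measurableSet_ball Metric.isBounded_ball]
  exact ENNReal.ofReal_lt_top

end MatrixMeasure

/-- Both `M - N` and `N - M` are positive semidefinite, and the Loewner order is antisymmetric. -/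
theorem Matrix.PosSemidef.eq_of_qform_eq {n : ℕ} {M N : Matrix (Fin n) (Fin n) ℂ}
    (hM : M.PosSemidef) (hN : N.PosSemidef) (h : ∀ x, qform M x = qform N x) : M = N := by
  have key : ∀ A B : Matrix (Fin n) (Fin n) ℂ, A.IsHermitian → B.IsHermitian →
      (∀ x, qform A x = qform B x) → (A - B).PosSemidef := by
    intro A B hA hB hAB
    refine Matrix.PosSemidef.of_dotProduct_mulVec_nonneg (hA.sub hB) fun x => ?_
    have h1 : (star x ⬝ᵥ (A - B) *ᵥ x).re = 0 := by
      rw [Matrix.sub_mulVec, dotProduct_sub, Complex.sub_re]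
      exact sub_eq_zero.2 (hAB x)
    have h2 : (star x ⬝ᵥ (A - B) *ᵥ x).im = 0 := (hA.sub hB).im_star_dotProduct_mulVec_self x
    rw [show star x ⬝ᵥ (A - B) *ᵥ x = 0 from Complex.ext h1 h2]
  have h1 := key M N hM.1 hN.1 h
  have h2 := key N M hN.1 hM.1 fun x => (h x).symm
  open MatrixOrder in
  exact le_antisymm (Matrix.le_iff.2 h2) (Matrix.le_iff.2 h1)

theorem IsClarkMeasure.unique {n : ℕ} {F : ℂ → Matrix (Fin n) (Fin n) ℂ} {μ ν : MatrixMeasure n}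
    (hμ : IsClarkMeasure F μ) (hν : IsClarkMeasure F ν) : μ = ν := by
  obtain ⟨c, -, hc⟩ := hμ
  obtain ⟨d, -, hd⟩ := hν
  refine MatrixMeasure.ext_of_forall fun Ω hm hb =>
    (μ.posSemidef' Ω hm hb).eq_of_qform_eq (ν.posSemidef' Ω hm hb) fun x => ?_
  have hs : μ.scalar x = ν.scalar x := by
    refine measure_eq_of_poisson_eq (hc x).1 (hd x).1 (c := qform c x) (d := qform d x)
      fun y hy s => ?_
    have hw : (⟨s, y⟩ : ℂ) ∈ upperHalf := hy
    have h := ((hc x).2 _ hw).symm.trans ((hd x).2 _ hw)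
    simpa only [linePoisson_eq_re] using h
  have h := congrArg (fun m => m Ω) hs
  simp only [MatrixMeasure.scalar_apply _ _ hm hb] at h
  exact (ENNReal.ofReal_eq_ofReal_iff (μ.qform_nonneg x hm hb) (ν.qform_nonneg x hm hb)).1 h

/-! ### Herglotz representation on the unit disk. -/

/-- An ultrafilter of radii tending to `1` from below. -/
def radialUltrafilter : Ultrafilter ℝ := Ultrafilter.of (𝓝[<] 1)

theorem radialUltrafilter_le : (radialUltrafilter : Filter ℝ) ≤ 𝓝[<] 1 := Ultrafilter.of_le _

theorem eventually_radial : ∀ᶠ r in radialUltrafilter, r ∈ Set.Ioo (0 : ℝ) 1 :=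
  radialUltrafilter_le (Ioo_mem_nhdsLT zero_lt_one)

theorem continuous_comp_circleMap {G : ℂ → ℂ} (hG : DifferentiableOn ℂ G (Metric.ball 0 1)) {r : ℝ}
    (hr : r ∈ Set.Ioo (0 : ℝ) 1) : Continuous fun θ => G (circleMap 0 r θ) :=
  hG.continuousOn.comp_continuous (continuous_circleMap 0 r) fun θ => by
    simp [abs_of_pos hr.1, hr.2]

/-- The measure has density `Re G / 2π` on the circle of radius `r`. Its mass is `Re G(0)` by the
mean value property; with the compact carrier this gives weak compactness uniformly in `r`. The
carrier is closed because a limit may charge both ends, which are the same boundary point `1`. -/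
theorem exists_circle_finiteMeasure {G : ℂ → ℂ} (hG : DifferentiableOn ℂ G (Metric.ball 0 1))
    (hpos : ∀ z ∈ Metric.ball (0 : ℂ) 1, 0 ≤ (G z).re) {r : ℝ} (hr : r ∈ Set.Ioo (0 : ℝ) 1) :
    ∃ ρ : FiniteMeasure ℝ, (ρ.mass ≤ (G 0).re.toNNReal ∧ ρ (Set.Icc 0 (2 * Real.pi))ᶜ = 0) ∧
      ∀ f : BoundedContinuousFunction ℝ ℝ, ∫ θ, f θ ∂(ρ : Measure ℝ) =
        ∫ θ in Set.Ioc 0 (2 * Real.pi), f θ * ((2 * Real.pi)⁻¹ * (G (circleMap 0 r θ)).re) := by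
  have hc := continuous_comp_circleMap hG hr
  set g : ℝ → ℝ := fun θ => (2 * Real.pi)⁻¹ * (G (circleMap 0 r θ)).re with hg
  have hgc : Continuous g := continuous_const.mul (Complex.continuous_re.comp hc)
  have hg0 : ∀ θ, 0 ≤ g θ := fun θ => by
    have := hpos (circleMap 0 r θ) (by simp [abs_of_pos hr.1, hr.2])
    have := Real.pi_pos
    simp only [hg]
    positivity
  have hgi : Integrable g (volume.restrict (Set.Ioc 0 (2 * Real.pi))) :=
    (hgc.integrableOn_Icc).mono_set Set.Ioc_subset_Icc_self
  have hfin := isFiniteMeasure_withDensity_ofReal hgi.2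
  let ρ : FiniteMeasure ℝ :=
    ⟨(volume.restrict (Set.Ioc 0 (2 * Real.pi))).withDensity fun θ => ENNReal.ofReal (g θ), hfin⟩
  have hint : ∀ f : BoundedContinuousFunction ℝ ℝ, ∫ θ, f θ ∂(ρ : Measure ℝ) =
      ∫ θ in Set.Ioc 0 (2 * Real.pi), f θ * g θ := by
    intro f
    change ∫ θ, f θ ∂(Measure.withDensity _ _) = _
    rw [integral_withDensity_eq_integral_toReal_smul (by fun_prop) (by simp)]
    refine integral_congr_ae (.of_forall fun θ => ?_)
    simp [ENNReal.toReal_ofReal (hg0 θ), mul_comm]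
  refine ⟨ρ, ⟨?_, ?_⟩, hint⟩
  · have h1 := hint (BoundedContinuousFunction.const ℝ 1)
    have hd : DiffContOnCl ℂ G (Metric.ball 0 |r|) := by
      refine DifferentiableOn.diffContOnCl (hG.mono ?_)
      rw [abs_of_pos hr.1]
      exact (Metric.closure_ball_subset_closedBall).trans (Metric.closedBall_subset_ball hr.2)
    have h2 := congrArg Complex.re hd.circleAverage
    rw [Real.circleAverage, intervalIntegral.integral_of_le (by positivity)] at h2
    simp only [BoundedContinuousFunction.const_apply, integral_const, smul_eq_mul, mul_one,
      one_mul] at h1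
    have h3 : (∫ θ in Set.Ioc 0 (2 * Real.pi), G (circleMap 0 r θ)).re =
        ∫ θ in Set.Ioc 0 (2 * Real.pi), (G (circleMap 0 r θ)).re :=
      (integral_re (𝕜 := ℂ) ((hc.integrableOn_Icc).mono_set Set.Ioc_subset_Icc_self)).symm
    rw [Complex.real_smul, Complex.re_ofReal_mul, h3, ← integral_const_mul] at h2
    have h4 : (ρ : Measure ℝ).real Set.univ = (G 0).re := h1.trans h2
    rw [← NNReal.coe_le_coe, Real.coe_toNNReal', ← h4]
    exact le_max_left _ _
  · rw [FiniteMeasure.null_iff_toMeasure_null]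
    refine withDensity_absolutelyContinuous _ _ ?_
    rw [Measure.restrict_apply measurableSet_Icc.compl]
    rw [(Set.disjoint_compl_left_iff_subset.2 Set.Ioc_subset_Icc_self).inter_eq, measure_empty]

/-- The boundary measure of an analytic function with nonnegative real part on the unit disk, as a
weak limit along `radialUltrafilter`. -/
theorem exists_boundary_measure {G : ℂ → ℂ} (hG : DifferentiableOn ℂ G (Metric.ball 0 1))
    (hpos : ∀ z ∈ Metric.ball (0 : ℂ) 1, 0 ≤ (G z).re) :
    ∃ σ : FiniteMeasure ℝ, ∀ f : BoundedContinuousFunction ℝ ℝ,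
      Tendsto (fun r => ∫ θ in Set.Ioc 0 (2 * Real.pi),
        f θ * ((2 * Real.pi)⁻¹ * (G (circleMap 0 r θ)).re)) radialUltrafilter
        (𝓝 (∫ θ, f θ ∂(σ : Measure ℝ))) := by
  have h := fun r (hr : r ∈ Set.Ioo (0 : ℝ) 1) => exists_circle_finiteMeasure hG hpos hr
  choose! ρ hρ using h
  -- An ultrafilter on a compact set converges, so no subsequence depending on `G` has to be chosen.
  obtain ⟨σ, -, hσ⟩ := (isCompact_setOfPred_finiteMeasure_le_of_isCompact (E := ℝ)
    (G 0).re.toNNReal (isCompact_Icc (a := 0) (b := 2 * Real.pi))).ultrafilter_le_nhds'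
    (radialUltrafilter.map ρ)
    (Ultrafilter.mem_map.2 (eventually_radial.mono fun r hr => (hρ r hr).1))
  refine ⟨σ, fun f => ?_⟩
  have ht : Tendsto ρ radialUltrafilter (𝓝 σ) := hσ
  refine (FiniteMeasure.tendsto_iff_forall_integral_tendsto.1 ht f).congr' ?_
  filter_upwards [eventually_radial] with r hr
  exact (hρ r hr).2 f

/-- The disk Poisson kernel with pole `z`, as a function of the angle. -/
def diskPoisson (z : ℂ) (θ : ℝ) : ℝ := ((circleMap 0 1 θ + z) / (circleMap 0 1 θ - z)).re

theorem circleMap_sub_ne_zero {z : ℂ} (hz : z ∈ Metric.ball (0 : ℂ) 1) (θ : ℝ) :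
    circleMap 0 1 θ - z ≠ 0 := by
  intro h
  have h1 : ‖circleMap 0 1 θ‖ = 1 := by simp
  rw [sub_eq_zero.1 h] at h1
  simp [h1] at hz

theorem continuous_diskPoisson {z : ℂ} (hz : z ∈ Metric.ball (0 : ℂ) 1) :
    Continuous (diskPoisson z) :=
  Complex.continuous_re.comp (((continuous_circleMap 0 1).add continuous_const).div
    ((continuous_circleMap 0 1).sub continuous_const) (circleMap_sub_ne_zero hz))

theorem abs_diskPoisson_le {z : ℂ} (hz : z ∈ Metric.ball (0 : ℂ) 1) (θ : ℝ) :
    ‖diskPoisson z θ‖ ≤ (1 + ‖z‖) / (1 - ‖z‖) := by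
  have hz' : ‖z‖ < 1 := by simpa using hz
  refine (Complex.abs_re_le_norm _).trans ?_
  rw [norm_div]
  have h1 : ‖circleMap 0 1 θ‖ = 1 := by simp
  have h2 := norm_add_le (circleMap 0 1 θ) z
  have h3 := norm_sub_norm_le (circleMap 0 1 θ) z
  rw [h1] at h2 h3
  exact div_le_div₀ (by positivity) h2 (by linarith) h3

theorem integrable_diskPoisson (σ : FiniteMeasure ℝ) {z : ℂ} (hz : z ∈ Metric.ball (0 : ℂ) 1) :
    Integrable (diskPoisson z) (σ : Measure ℝ) :=
  (BoundedContinuousFunction.ofNormedAddCommGroup (diskPoisson z) (continuous_diskPoisson hz) _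
    (abs_diskPoisson_le hz)).integrable _

/-- **Herglotz representation** on the unit disk. -/
theorem re_eq_integral_diskPoisson {G : ℂ → ℂ} (hG : DifferentiableOn ℂ G (Metric.ball 0 1))
    {σ : FiniteMeasure ℝ} (hσ : ∀ f : BoundedContinuousFunction ℝ ℝ,
      Tendsto (fun r => ∫ θ in Set.Ioc 0 (2 * Real.pi),
        f θ * ((2 * Real.pi)⁻¹ * (G (circleMap 0 r θ)).re)) radialUltrafilter
        (𝓝 (∫ θ, f θ ∂(σ : Measure ℝ)))) {z : ℂ} (hz : z ∈ Metric.ball (0 : ℂ) 1) :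
    (G z).re = ∫ θ, diskPoisson z θ ∂(σ : Measure ℝ) := by
  have h1 := hσ (BoundedContinuousFunction.ofNormedAddCommGroup (diskPoisson z)
    (continuous_diskPoisson hz) _ (abs_diskPoisson_le hz))
  simp only [BoundedContinuousFunction.coe_ofNormedAddCommGroup] at h1
  refine tendsto_nhds_unique ?_ h1
  have h2 : Tendsto (fun r : ℝ => (G (r * z)).re) radialUltrafilter (𝓝 (G z).re) := by
    have hc : ContinuousAt G z := (hG.continuousOn).continuousAt (Metric.isOpen_ball.mem_nhds hz)
    refine ((Complex.continuous_re.tendsto _).comp hc.tendsto).comp ?_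
    have : Tendsto (fun r : ℝ => (r : ℂ) * z) (𝓝 1) (𝓝 (((1 : ℝ) : ℂ) * z)) :=
      Continuous.tendsto (by fun_prop) 1
    rw [Complex.ofReal_one, one_mul] at this
    exact this.mono_left (radialUltrafilter_le.trans nhdsWithin_le_nhds)
  refine h2.congr' ?_
  filter_upwards [eventually_radial] with r hr
  -- The dilate `G(r ·)` is continuous up to the unit circle, so the classical Poisson formula
  -- applies to it at `z`.
  have hd : DiffContOnCl ℂ (fun w : ℂ => G (r * w)) (Metric.ball 0 1) := by
    refine DifferentiableOn.diffContOnCl (hG.comp (by fun_prop) fun w hw => ?_)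
    have hw' : ‖w‖ ≤ 1 := by
      simpa using Metric.closure_ball_subset_closedBall hw
    have : r * ‖w‖ ≤ r := mul_le_of_le_one_right hr.1.le hw'
    simpa [abs_of_pos hr.1] using this.trans_lt hr.2
  have h3 := congrArg Complex.re (hd.circleAverage_re_herglotzRieszKernel_smul hz)
  have h4 : ∀ θ, ((Complex.re ∘ herglotzRieszKernel 0 z) • fun w : ℂ => G (r * w))
      (circleMap 0 1 θ) = diskPoisson z θ • G (circleMap 0 r θ) := by
    intro θ
    have : (r : ℂ) * circleMap 0 1 θ = circleMap 0 r θ := by simp [circleMap]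
    simp [herglotzRieszKernel, diskPoisson, this]
  have h5 : Continuous fun θ => diskPoisson z θ • G (circleMap 0 r θ) :=
    (continuous_diskPoisson hz).smul (continuous_comp_circleMap hG hr)
  have h6 : (∫ θ in Set.Ioc 0 (2 * Real.pi), diskPoisson z θ • G (circleMap 0 r θ)).re =
      ∫ θ in Set.Ioc 0 (2 * Real.pi), (diskPoisson z θ • G (circleMap 0 r θ)).re :=
    (integral_re (𝕜 := ℂ) ((h5.integrableOn_Icc).mono_set Set.Ioc_subset_Icc_self)).symm
  rw [← h3, Real.circleAverage, intervalIntegral.integral_of_le (by positivity),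
    Complex.real_smul, Complex.re_ofReal_mul]
  simp only [h4]
  rw [h6, ← integral_const_mul]
  refine integral_congr_ae (.of_forall fun θ => ?_)
  simp only [Complex.real_smul, Complex.re_ofReal_mul]
  ring

/-! ### Polarization: quadratic dependence through finitely many vectors. -/

theorem qform_single_add_single {n : ℕ} (M : Matrix (Fin n) (Fin n) ℂ) (j k : Fin n) (a b : ℂ) :
    qform M (Pi.single j a + Pi.single k b) =
      (star a * M j j * a + star a * M j k * b + star b * M k j * a + star b * M k k * b).re := by
  simp only [qform, star_add, ← Pi.single_star, Matrix.mulVec_add, add_dotProduct,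
    dotProduct_add, Matrix.mulVec_single, single_dotProduct, Pi.smul_apply, Matrix.col_apply,
    MulOpposite.smul_eq_mul_unop, MulOpposite.unop_op]
  congr 1
  ring

theorem qform_single {n : ℕ} (j k : Fin n) (a : ℂ) (x : Fin n → ℂ) :
    qform (Matrix.single j k a) x = (star (x j) * (a * x k)).re := by
  rw [qform, Matrix.single_mulVec, ← Pi.single, dotProduct_single, Pi.star_apply]

/-- The quadratic form at a fixed vector, as a real linear functional of the matrix. -/
def qformLinear {n : ℕ} (x : Fin n → ℂ) : Matrix (Fin n) (Fin n) ℂ →ₗ[ℝ] ℝ where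
  toFun M := qform M x
  map_add' A B := by simp [qform, Matrix.add_mulVec, dotProduct_add]
  map_smul' r A := by simp [qform, Matrix.smul_mulVec, dotProduct_smul]

theorem qform_eq_sum {n : ℕ} (M : Matrix (Fin n) (Fin n) ℂ) (x : Fin n → ℂ) :
    qform M x = ∑ j, ∑ k, (star (x j) * M j k * x k).re := by
  simp [qform, dotProduct, Matrix.mulVec, Finset.mul_sum, mul_assoc]

/-- Finitely many vectors determine a quadratic form, with a Hermitian dual family. -/
theorem exists_qform_dual (n : ℕ) : ∃ (ι : Type) (_ : Fintype ι) (v : ι → Fin n → ℂ)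
    (N : ι → Matrix (Fin n) (Fin n) ℂ), (∀ i, (N i).IsHermitian) ∧
      ∀ M x, qform M x = ∑ i, qform M (v i) * qform (N i) x := by
  let A : Fin n → Fin n → Matrix (Fin n) (Fin n) ℂ := fun j k =>
    Matrix.single j k (1 / 4) + Matrix.single k j (1 / 4)
  let B : Fin n → Fin n → Matrix (Fin n) (Fin n) ℂ := fun j k =>
    Matrix.single j k (Complex.I / 8) + Matrix.single k j (-Complex.I / 8)
  have hA : ∀ j k, (A j k).IsHermitian := fun j k => by
    simp [A, Matrix.IsHermitian, Matrix.conjTranspose_add, Matrix.conjTranspose_single, add_comm]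
  have hB : ∀ j k, (B j k).IsHermitian := fun j k => by
    simp [B, Matrix.IsHermitian, Matrix.conjTranspose_add, Matrix.conjTranspose_single, add_comm]
  -- For each pair the vectors are `e_j + e_k`, `e_j`, `e_k`, `i e_j + e_k`, `e_j + i e_k`, padded
  -- with zero entries to share one formula. The first three isolate `Re (M_jk + M_kj)`, the last
  -- two `2 Im (M_jk - M_kj)`; the weights `1/4` and `1/8` compensate for summing over ordered pairs
  -- and for that `2`.
  refine ⟨(Fin n × Fin n) × Fin 5, inferInstance,
    fun p => ![Pi.single p.1.1 1 + Pi.single p.1.2 1, Pi.single p.1.1 1 + Pi.single p.1.2 0,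
      Pi.single p.1.1 0 + Pi.single p.1.2 1, Pi.single p.1.1 Complex.I + Pi.single p.1.2 1,
      Pi.single p.1.1 1 + Pi.single p.1.2 Complex.I] p.2,
    fun p => ![A p.1.1 p.1.2, -A p.1.1 p.1.2, -A p.1.1 p.1.2, B p.1.1 p.1.2, -B p.1.1 p.1.2] p.2,
    fun p => ?_, fun M x => ?_⟩
  · obtain ⟨⟨j, k⟩, l⟩ := p
    fin_cases l
    exacts [hA j k, (hA j k).neg, (hA j k).neg, hB j k, (hB j k).neg]
  · have hneg : ∀ C : Matrix (Fin n) (Fin n) ℂ, qform (-C) x = -qform C x :=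
      (qformLinear x).map_neg
    have hadd : ∀ C D : Matrix (Fin n) (Fin n) ℂ, qform (C + D) x = qform C x + qform D x :=
      (qformLinear x).map_add
    have h : ∀ j k : Fin n, ∑ l : Fin 5,
        qform M (![Pi.single j 1 + Pi.single k 1, Pi.single j 1 + Pi.single k 0,
          Pi.single j 0 + Pi.single k 1, Pi.single j Complex.I + Pi.single k 1,
          Pi.single j 1 + Pi.single k Complex.I] l) *
        qform (![A j k, -A j k, -A j k, B j k, -B j k] l) x =
        ((star (x j) * M j k * x k).re + (star (x k) * M k j * x j).re) / 2 := by
      intro j k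
      rw [Fin.sum_univ_five]
      simp only [Matrix.cons_val, hneg, hadd, A, B, qform_single, qform_single_add_single]
      simp [Complex.mul_re, Complex.mul_im]
      ring
    rw [Fintype.sum_prod_type, Fintype.sum_prod_type]
    simp only [h]
    simp only [← Finset.sum_div, Finset.sum_add_distrib]
    rw [Finset.sum_comm (f := fun j k => (star (x k) * M k j * x j).re), qform_eq_sum]
    ring

/-- The coefficients have both signs. Moving the negative ones to the left gives an equality of
finite measures tested on bounded continuous functions, hence an equality of measures, valid for
every integrable `f`. -/
theorem integral_eq_sum_of_forall_boundedContinuous {ι : Type*} [Fintype ι] {σ : Measure ℝ}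
    [IsFiniteMeasure σ] {τ : ι → Measure ℝ} [∀ i, IsFiniteMeasure (τ i)] {c : ι → ℝ}
    (h : ∀ f : BoundedContinuousFunction ℝ ℝ, ∫ t, f t ∂σ = ∑ i, c i * ∫ t, f t ∂(τ i))
    {f : ℝ → ℝ} (hf : Integrable f σ) (hf' : ∀ i, Integrable f (τ i)) :
    ∫ t, f t ∂σ = ∑ i, c i * ∫ t, f t ∂(τ i) := by
  let μ := ∑ i, (-c i).toNNReal • τ i
  let ν := ∑ i, (c i).toNNReal • τ i
  have hint : ∀ {g : ℝ → ℝ}, (∀ i, Integrable g (τ i)) → ∀ a : ι → NNReal,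
      Integrable g (∑ i, a i • τ i) := fun {g} hg a =>
    integrable_finsetSum_measure.2 fun i _ => (hg i).smul_measure_nnreal
  have hsum : ∀ {g : ℝ → ℝ}, (∀ i, Integrable g (τ i)) → ∀ a : ι → NNReal,
      ∫ t, g t ∂(∑ i, a i • τ i) = ∑ i, a i * ∫ t, g t ∂(τ i) := fun {g} hg a => by
    rw [integral_finsetSum_measure fun i _ => (hg i).smul_measure_nnreal]
    simp only [integral_smul_nnreal_measure]
    rfl
  have hdiff : ∀ a : ι → ℝ, ∑ i, c i * a i =
      ∑ i, (c i).toNNReal * a i - ∑ i, (-c i).toNNReal * a i := fun a => by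
    rw [← Finset.sum_sub_distrib]
    refine Finset.sum_congr rfl fun i _ => ?_
    rw [← sub_mul, Real.coe_toNNReal', Real.coe_toNNReal', max_zero_sub_max_neg_zero_eq_self]
  have heq : σ + μ = ν := by
    refine ext_of_forall_integral_eq_of_IsFiniteMeasure fun g => ?_
    have hg : ∀ i, Integrable g (τ i) := fun i => g.integrable _
    rw [integral_add_measure (g.integrable _) (hint hg _), hsum hg, hsum hg, h, hdiff]
    ring
  have h1 := congrArg (fun m => ∫ t, f t ∂m) heq
  rw [integral_add_measure hf (hint hf' _), hsum hf', hsum hf'] at h1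
  rw [hdiff]
  linarith

/-! ### Analyticity and positivity of the Nevanlinna function. -/

section Nevanlinna

variable {n : ℕ}

theorem differentiableOn_matrix_det {m : ℕ} {M : ℂ → Matrix (Fin m) (Fin m) ℂ} {X : Set ℂ}
    (hM : ∀ i j, DifferentiableOn ℂ (fun w => M w i j) X) :
    DifferentiableOn ℂ (fun w => (M w).det) X := by
  simp only [Matrix.det_apply']
  fun_prop

theorem differentiableOn_matrix_inv {m : ℕ} {M : ℂ → Matrix (Fin m) (Fin m) ℂ} {X : Set ℂ}
    (hM : ∀ i j, DifferentiableOn ℂ (fun w => M w i j) X) (hu : ∀ w ∈ X, IsUnit (M w))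
    (i j : Fin m) : DifferentiableOn ℂ (fun w => (M w)⁻¹ i j) X := by
  simp only [Matrix.inv_def, Ring.inverse_eq_inv', Matrix.smul_apply, smul_eq_mul]
  refine ((differentiableOn_matrix_det hM).inv fun w hw => ?_).mul ?_
  · exact ((Matrix.isUnit_iff_isUnit_det _).1 (hu w hw)).ne_zero
  · simp only [Matrix.adjugate_apply]
    refine differentiableOn_matrix_det fun k l => ?_
    by_cases hk : k = j
    · subst hk
      simp only [Matrix.updateRow_self]
      fun_prop
    · simp only [Matrix.updateRow_ne hk]
      exact hM k l

theorem differentiableOn_matrix_mul_apply {m : ℕ} {M N : ℂ → Matrix (Fin m) (Fin m) ℂ} {X : Set ℂ}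
    (hM : ∀ i j, DifferentiableOn ℂ (fun w => M w i j) X)
    (hN : ∀ i j, DifferentiableOn ℂ (fun w => N w i j) X) (i j : Fin m) :
    DifferentiableOn ℂ (fun w => (M w * N w) i j) X := by
  simp only [Matrix.mul_apply]
  fun_prop

theorem differentiableOn_nevanlinna {F : ℂ → Matrix (Fin n) (Fin n) ℂ} {X : Set ℂ}
    (hF : ∀ i j, DifferentiableOn ℂ (fun w => F w i j) X) (hu : ∀ w ∈ X, IsUnit (1 - F w))
    (i j : Fin n) : DifferentiableOn ℂ (fun w => nevanlinna F w i j) X := by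
  refine differentiableOn_matrix_mul_apply (differentiableOn_matrix_inv (fun k l => ?_) hu) (fun k l => ?_) i j
  · simp only [Matrix.sub_apply]
    fun_prop
  · simp only [Matrix.add_apply]
    fun_prop

theorem differentiableOn_dotProduct_mulVec {M : ℂ → Matrix (Fin n) (Fin n) ℂ} {X : Set ℂ}
    (hM : ∀ i j, DifferentiableOn ℂ (fun w => M w i j) X) (x : Fin n → ℂ) :
    DifferentiableOn ℂ (fun w => star x ⬝ᵥ (M w *ᵥ x)) X := by
  simp only [dotProduct, Matrix.mulVec]
  fun_prop

theorem re_star_dotProduct_mulVec_le {A : Matrix (Fin n) (Fin n) ℂ}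
    (hA : ‖Matrix.toEuclideanCLM (𝕜 := ℂ) A‖ ≤ 1) (z : Fin n → ℂ) :
    (star (A *ᵥ z) ⬝ᵥ (A *ᵥ z)).re ≤ (star z ⬝ᵥ z).re := by
  have key : ∀ y : Fin n → ℂ, (star y ⬝ᵥ y).re = ‖WithLp.toLp 2 y‖ ^ 2 := fun y => by
    rw [EuclideanSpace.norm_sq_eq]
    simp [dotProduct, Complex.sq_norm, Complex.normSq_apply]
  rw [key, key]
  have h := (Matrix.toEuclideanCLM (𝕜 := ℂ) A).le_of_opNorm_le hA (WithLp.toLp 2 z)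
  rw [one_mul, Matrix.toEuclideanCLM_toLp] at h
  gcongr

/-- With `z = (1 - F)⁻¹ x` one has `x = z - F z` and `H x = z + F z`, so `Re ⟨H x, x⟩ = ‖z‖² - ‖F
z‖²`. -/
theorem qform_nevanlinna_nonneg {F : ℂ → Matrix (Fin n) (Fin n) ℂ} {w : ℂ}
    (hF : ‖Matrix.toEuclideanCLM (𝕜 := ℂ) (F w)‖ ≤ 1) (hu : IsUnit (1 - F w)) (x : Fin n → ℂ) :
    0 ≤ qform (nevanlinna F w) x := by
  have hdet := (Matrix.isUnit_iff_isUnit_det _).1 hu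
  set z := (1 - F w)⁻¹ *ᵥ x with hz
  have hz' : (1 - F w) *ᵥ z = x := by
    rw [hz, Matrix.mulVec_mulVec, Matrix.mul_nonsing_inv _ hdet, Matrix.one_mulVec]
  have hx : x = z - F w *ᵥ z := by
    rw [← hz', Matrix.sub_mulVec, Matrix.one_mulVec]
  have hH : nevanlinna F w *ᵥ x = z + F w *ᵥ z := by
    have hcomm : (1 + F w) * (1 - F w) = (1 - F w) * (1 + F w) := by noncomm_ring
    rw [← hz', nevanlinna, Matrix.mulVec_mulVec, Matrix.mul_assoc, hcomm, ← Matrix.mul_assoc,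
      Matrix.nonsing_inv_mul _ hdet, Matrix.one_mul, Matrix.add_mulVec, Matrix.one_mulVec]
  have h := re_star_dotProduct_mulVec_le hF z
  rw [qform, hH, hx, star_sub, sub_dotProduct, dotProduct_add, dotProduct_add]
  have hc : (star (F w *ᵥ z) ⬝ᵥ z).re = (star z ⬝ᵥ (F w *ᵥ z)).re := by
    rw [← Complex.conj_re, ← Complex.star_def, ← Matrix.star_dotProduct]
  simp only [Complex.sub_re, Complex.add_re]
  linarith

end Nevanlinna

/-! ### Cayley transform between disk and half-plane. -/

/-- The inverse Cayley transform, from the unit disk to the upper half-plane. -/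
def cayleyInv (z : ℂ) : ℂ := Complex.I * (1 + z) / (1 - z)

theorem one_sub_ne_zero_of_mem_ball {z : ℂ} (hz : z ∈ Metric.ball (0 : ℂ) 1) : 1 - z ≠ 0 := by
  intro h
  rw [← sub_eq_zero.1 h] at hz
  simp at hz

theorem cayleyInv_mem {z : ℂ} (hz : z ∈ Metric.ball (0 : ℂ) 1) : cayleyInv z ∈ upperHalf := by
  have h1 := one_sub_ne_zero_of_mem_ball hz
  have h2 : (cayleyInv z).im = (1 - ‖z‖ ^ 2) / Complex.normSq (1 - z) := by
    rw [cayleyInv, Complex.div_im, Complex.sq_norm, Complex.normSq_apply z]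
    simp
    ring
  have h3 : ‖z‖ < 1 := by simpa using hz
  change 0 < (cayleyInv z).im
  rw [h2]
  have := Complex.normSq_pos.2 h1
  have : 0 < 1 - ‖z‖ ^ 2 := by nlinarith [norm_nonneg z]
  positivity

theorem differentiableOn_cayleyInv : DifferentiableOn ℂ cayleyInv (Metric.ball 0 1) := by
  unfold cayleyInv
  exact DifferentiableOn.div (by fun_prop) (by fun_prop) fun z hz => one_sub_ne_zero_of_mem_ball hz

/-- The Cayley transform, from the upper half-plane to the unit disk. -/
def cayley (w : ℂ) : ℂ := (w - Complex.I) / (w + Complex.I)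

theorem add_I_ne_zero {w : ℂ} (hw : w ∈ upperHalf) : w + Complex.I ≠ 0 := by
  intro h
  have h1 := congrArg Complex.im h
  have h2 : 0 < w.im := hw
  simp at h1
  linarith

theorem cayley_mem {w : ℂ} (hw : w ∈ upperHalf) : cayley w ∈ Metric.ball (0 : ℂ) 1 := by
  have h1 := norm_pos_iff.2 (add_I_ne_zero hw)
  have h2 : 0 < w.im := hw
  rw [mem_ball_zero_iff, cayley, norm_div, div_lt_one h1]
  refine lt_of_pow_lt_pow_left₀ 2 h1.le ?_
  rw [Complex.sq_norm, Complex.sq_norm, Complex.normSq_apply, Complex.normSq_apply]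
  simp
  nlinarith

theorem cayleyInv_cayley {w : ℂ} (hw : w ∈ upperHalf) : cayleyInv (cayley w) = w := by
  have h1 := add_I_ne_zero hw
  have h2 : 1 - cayley w = 2 * Complex.I / (w + Complex.I) := by
    rw [cayley]
    field_simp
    ring
  have h3 : 1 + cayley w = 2 * w / (w + Complex.I) := by
    rw [cayley]
    field_simp
    ring
  rw [cayleyInv, h2, h3]
  have := Complex.I_ne_zero
  field_simp

/-- The real line as the image of the unit circle minus `1` under the inverse Cayley transform,
parametrized by the angle. -/
def angleLine (θ : ℝ) : ℝ := -(Real.cos (θ / 2) / Real.sin (θ / 2))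

/-- The angles of the point `1` of the unit circle. -/
def angleOne : Set ℝ := {θ | Real.sin (θ / 2) = 0}

theorem measurable_angleLine : Measurable angleLine := by
  unfold angleLine
  fun_prop

theorem measurableSet_angleOne : MeasurableSet angleOne :=
  (isClosed_eq (by fun_prop) (by fun_prop)).measurableSet

theorem circleMap_eq_sq (θ : ℝ) : circleMap 0 1 θ =
    ((Real.cos (θ / 2) : ℂ) + (Real.sin (θ / 2) : ℂ) * Complex.I) ^ 2 := by
  rw [Complex.ofReal_cos, Complex.ofReal_sin, ← Complex.exp_mul_I, ← Complex.exp_nat_mul]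
  simp only [circleMap, Complex.ofReal_one, one_mul, zero_add, Complex.ofReal_div]
  congr 1
  push_cast
  ring

/-- At the boundary point `1` the kernel is `Re (-i w)`. Mass there produces the linear term `c Im
w`. -/
theorem diskPoisson_cayley_of_mem {w : ℂ} (hw : w ∈ upperHalf) {θ : ℝ} (hθ : θ ∈ angleOne) :
    diskPoisson (cayley w) θ = w.im := by
  have hs : Real.sin (θ / 2) = 0 := hθ
  have hc : Real.cos (θ / 2) ^ 2 = 1 := by
    have := Real.sin_sq_add_cos_sq (θ / 2)
    rw [hs] at this
    linarith
  have h1 : circleMap 0 1 θ = 1 := by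
    rw [circleMap_eq_sq, hs]
    simp [← Complex.ofReal_pow, hc, -Complex.ofReal_cos]
  have h2 := cayleyInv_cayley hw
  have h3 : (1 + cayley w) / (1 - cayley w) = -Complex.I * w := by
    conv_rhs => rw [← h2]
    rw [cayleyInv, ← mul_div_assoc, ← mul_assoc]
    simp
  rw [diskPoisson, h1, h3]
  simp

/-- With `e^{iθ} = (t - i) / (t + i)` the kernel is the real part of `-i (t w + 1) / (t - w)`,
namely `(1 + t²) Im w / |t - w|²`. This dictates the density `π (1 + t²)`. -/
theorem diskPoisson_cayley_of_notMem {w : ℂ} (hw : w ∈ upperHalf) {θ : ℝ} (hθ : θ ∉ angleOne) :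
    diskPoisson (cayley w) θ =
      Real.pi * (1 + angleLine θ ^ 2) * linePoisson w.im (angleLine θ - w.re) := by
  have hs : Real.sin (θ / 2) ≠ 0 := hθ
  have hw' : 0 < w.im := hw
  set t := angleLine θ with ht
  have htw : (t : ℂ) - w ≠ 0 := by
    intro h
    have := congrArg Complex.im h
    simp at this
    exact hw'.ne' this
  have htI : (t : ℂ) + Complex.I ≠ 0 := by
    intro h
    have := congrArg Complex.im h
    simp at this
  have hwI := add_I_ne_zero hw
  have h1 : circleMap 0 1 θ = ((t : ℂ) - Complex.I) / (t + Complex.I) := by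
    rw [eq_div_iff htI, circleMap_eq_sq, ht, angleLine]
    have hs' : (Real.sin (θ / 2) : ℂ) ≠ 0 := Complex.ofReal_ne_zero.2 hs
    have hcs : (Real.cos (θ / 2) : ℂ) ^ 2 + (Real.sin (θ / 2) : ℂ) ^ 2 = 1 := by
      rw [← Complex.ofReal_pow, ← Complex.ofReal_pow, ← Complex.ofReal_add,
        Real.cos_sq_add_sin_sq, Complex.ofReal_one]
    rw [Complex.ofReal_neg, Complex.ofReal_div]
    generalize (Real.cos (θ / 2) : ℂ) = c at *
    generalize (Real.sin (θ / 2) : ℂ) = s at *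
    field_simp
    have hI := Complex.I_sq
    linear_combination (-(c + s * Complex.I)) * hcs + (c * s ^ 2 + s ^ 3 * Complex.I) * hI
  have h2 : (circleMap 0 1 θ + cayley w) / (circleMap 0 1 θ - cayley w) =
      -Complex.I * (t * w + 1) / (t - w) := by
    have hne := circleMap_sub_ne_zero (cayley_mem hw) θ
    rw [div_eq_div_iff hne htw, h1, cayley]
    field_simp
    have hI := Complex.I_sq
    ring_nf
    simp only [hI]
    ring
  rw [diskPoisson, h2, Complex.div_re, linePoisson, Complex.normSq_apply]
  simp
  have hpos' : 0 < (t - w.re) ^ 2 + w.im ^ 2 := by positivity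
  have hpos : 0 < (t - w.re) * (t - w.re) + w.im * w.im := by nlinarith
  have := Real.pi_pos
  field_simp
  ring

/-! ### Assembling the matrix-valued measure on the line. -/

theorem qform_sum_smul {n : ℕ} {ι : Type*} [Fintype ι] (r : ι → ℝ)
    (N : ι → Matrix (Fin n) (Fin n) ℂ) (x : Fin n → ℂ) :
    qform (∑ i, r i • N i) x = ∑ i, r i * qform (N i) x := by
  change qformLinear x _ = _
  rw [map_sum]
  simp only [map_smul, smul_eq_mul]
  rfl

theorem posSemidef_of_qform_nonneg {n : ℕ} {M : Matrix (Fin n) (Fin n) ℂ} (hM : M.IsHermitian)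
    (h : ∀ x, 0 ≤ qform M x) : M.PosSemidef := by
  refine Matrix.PosSemidef.of_dotProduct_mulVec_nonneg hM fun x => ?_
  rw [Complex.nonneg_iff]
  exact ⟨h x, (hM.im_star_dotProduct_mulVec_self x).symm⟩

theorem isHermitian_sum_smul {n : ℕ} {ι : Type*} [Fintype ι] (r : ι → ℝ)
    {N : ι → Matrix (Fin n) (Fin n) ℂ} (hN : ∀ i, (N i).IsHermitian) :
    (∑ i, r i • N i).IsHermitian := by
  rw [Matrix.IsHermitian, Matrix.conjTranspose_sum]
  refine Finset.sum_congr rfl fun i _ => ?_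
  rw [Matrix.conjTranspose_smul, (hN i).eq, star_trivial]

/-- The density of the change of variables from the circle to the line. -/
def angleWeight (θ : ℝ) : ℝ := Real.pi * (1 + angleLine θ ^ 2)

/-- The angles that are mapped to `Ω` by the inverse Cayley transform. -/
def angleSet (Ω : Set ℝ) : Set ℝ := angleOneᶜ ∩ angleLine ⁻¹' Ω

theorem measurable_angleWeight : Measurable angleWeight := by
  have := measurable_angleLine
  unfold angleWeight
  fun_prop

theorem angleWeight_nonneg (θ : ℝ) : 0 ≤ angleWeight θ := by
  have := Real.pi_pos
  unfold angleWeight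
  positivity

theorem measurableSet_angleSet {Ω : Set ℝ} (hΩ : MeasurableSet Ω) : MeasurableSet (angleSet Ω) :=
  measurableSet_angleOne.compl.inter (measurable_angleLine hΩ)

/-- The weight blows up at the boundary point `1`, but is bounded on angles mapped into a bounded
set. Angles of `1` itself are removed in `angleSet`, as division by zero makes `angleLine` equal `0`
there. -/
theorem integrableOn_angleWeight (σ : Measure ℝ) [IsFiniteMeasure σ] {Ω : Set ℝ}
    (hm : MeasurableSet Ω) (hb : Bornology.IsBounded Ω) :
    IntegrableOn angleWeight (angleSet Ω) σ := by
  obtain ⟨K, hK⟩ := hb.exists_norm_le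
  refine Measure.integrableOn_of_bounded (M := Real.pi * (1 + K ^ 2)) (measure_ne_top _ _)
    measurable_angleWeight.aestronglyMeasurable ?_
  filter_upwards [ae_restrict_mem (measurableSet_angleSet hm)] with θ hθ
  rw [Real.norm_eq_abs, abs_of_nonneg (angleWeight_nonneg θ), angleWeight]
  have h := hK _ hθ.2
  have := Real.pi_pos
  have h2 : angleLine θ ^ 2 ≤ K ^ 2 := by
    rw [← sq_abs]
    exact pow_le_pow_left₀ (abs_nonneg _) h 2
  gcongr

/-- A weakly quadratic family of finite measures on the circle, given by its values at finitely many
vectors. -/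
structure QuadraticFamily (n : ℕ) where
  measure : (Fin n → ℂ) → FiniteMeasure ℝ
  index : Type
  [fintype : Fintype index]
  vec : index → Fin n → ℂ
  mat : index → Matrix (Fin n) (Fin n) ℂ
  isHermitian : ∀ i, (mat i).IsHermitian
  integral_eq : ∀ (f : BoundedContinuousFunction ℝ ℝ) (x : Fin n → ℂ),
    ∫ θ, f θ ∂(measure x : Measure ℝ) =
      ∑ i, qform (mat i) x * ∫ θ, f θ ∂(measure (vec i) : Measure ℝ)

namespace QuadraticFamily

variable {n : ℕ} (S : QuadraticFamily n)

attribute [instance] QuadraticFamily.fintype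

/-- The matrix-valued integral over a set. -/
def setIntegral (f : ℝ → ℝ) (X : Set ℝ) : Matrix (Fin n) (Fin n) ℂ :=
  ∑ i, (∫ θ in X, f θ ∂(S.measure (S.vec i) : Measure ℝ)) • S.mat i

/-- The matrix is built from the vectors `S.vec i` alone; quadraticity, extended from continuous
functions to the indicator of `X` times `f`, gives the right form at every `x`. -/
theorem qform_setIntegral {f : ℝ → ℝ} {X : Set ℝ} (hX : MeasurableSet X)
    (hf : ∀ x, IntegrableOn f X (S.measure x : Measure ℝ)) (x : Fin n → ℂ) :
    qform (S.setIntegral f X) x = ∫ θ in X, f θ ∂(S.measure x : Measure ℝ) := by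
  have h := integral_eq_sum_of_forall_boundedContinuous (fun f => S.integral_eq f x)
    ((integrable_indicator_iff hX).2 (hf x))
    (fun i => (integrable_indicator_iff hX).2 (hf (S.vec i)))
  simp only [integral_indicator hX] at h
  rw [h, setIntegral, qform_sum_smul]
  exact Finset.sum_congr rfl fun i _ => mul_comm _ _

theorem posSemidef_setIntegral {f : ℝ → ℝ} {X : Set ℝ} (hX : MeasurableSet X)
    (hf : ∀ x, IntegrableOn f X (S.measure x : Measure ℝ)) (h0 : ∀ θ, 0 ≤ f θ) :
    (S.setIntegral f X).PosSemidef :=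
  posSemidef_of_qform_nonneg (isHermitian_sum_smul _ S.isHermitian) fun x => by
    rw [S.qform_setIntegral hX hf]
    exact integral_nonneg h0

open Classical in
/-- The matrix-valued measure on the line obtained by the inverse Cayley transform. -/
def lineMeasure : MatrixMeasure n where
  toFun Ω := if MeasurableSet Ω ∧ Bornology.IsBounded Ω then S.setIntegral angleWeight (angleSet Ω)
    else 0
  posSemidef' Ω hm hb := by
    rw [if_pos ⟨hm, hb⟩]
    exact S.posSemidef_setIntegral (measurableSet_angleSet hm)
      (fun x => integrableOn_angleWeight _ hm hb) angleWeight_nonneg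
  hasSum' f hm hd hb := by
    have h1 : ∀ k, Bornology.IsBounded (f k) := fun k => hb.subset (Set.subset_iUnion f k)
    simp only [hm, h1, hb, MeasurableSet.iUnion hm, and_self, if_true]
    refine hasSum_sum fun i _ => HasSum.smul_const ?_ _
    have h2 : angleSet (⋃ k, f k) = ⋃ k, angleSet (f k) := by
      simp only [angleSet, Set.preimage_iUnion, Set.inter_iUnion]
    have h3 := integrableOn_angleWeight (S.measure (S.vec i) : Measure ℝ) (.iUnion hm) hb
    rw [h2] at h3 ⊢
    exact hasSum_integral_iUnion (fun k => measurableSet_angleSet (hm k))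
      (fun j k hjk => ((hd hjk).preimage _).mono Set.inter_subset_right Set.inter_subset_right) h3
  eq_zero' Ω hΩ := if_neg hΩ

theorem qform_lineMeasure {Ω : Set ℝ} (hm : MeasurableSet Ω) (hb : Bornology.IsBounded Ω)
    (x : Fin n → ℂ) : qform (S.lineMeasure Ω) x =
      ∫ θ in angleSet Ω, angleWeight θ ∂(S.measure x : Measure ℝ) := by
  have h : S.lineMeasure Ω = S.setIntegral angleWeight (angleSet Ω) := if_pos ⟨hm, hb⟩
  rw [h]
  exact S.qform_setIntegral (measurableSet_angleSet hm)
    (fun x => integrableOn_angleWeight _ hm hb) x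

end QuadraticFamily

theorem MatrixMeasure.eq_scalar {n : ℕ} {μ : MatrixMeasure n} {x : Fin n → ℂ} {ν : Measure ℝ}
    (h : ∀ Ω, MeasurableSet Ω → Bornology.IsBounded Ω → ν Ω = ENNReal.ofReal (qform (μ Ω) x)) :
    μ.scalar x = ν := by
  ext Ω hΩ
  have hm : ∀ k, MeasurableSet (Ω ∩ shell k) := fun k => hΩ.inter (measurableSet_shell k)
  have hb : ∀ k, Bornology.IsBounded (Ω ∩ shell k) := fun k =>
    (isBounded_shell k).subset Set.inter_subset_right
  have hd : Pairwise (Function.onFun Disjoint fun k => Ω ∩ shell k) := fun i j hij =>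
    (disjoint_shell hij).mono Set.inter_subset_right Set.inter_subset_right
  rw [← iUnion_inter_shell Ω, measure_iUnion hd hm, measure_iUnion hd hm]
  exact tsum_congr fun k => by rw [scalar_apply _ _ (hm k) (hb k), h _ (hm k) (hb k)]

namespace QuadraticFamily

variable {n : ℕ} (S : QuadraticFamily n)

theorem scalar_lineMeasure (x : Fin n → ℂ) : S.lineMeasure.scalar x =
    Measure.map angleLine (((S.measure x : Measure ℝ).restrict angleOneᶜ).withDensity
      fun θ => ENNReal.ofReal (angleWeight θ)) := by
  refine MatrixMeasure.eq_scalar fun Ω hm hb => ?_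
  rw [Measure.map_apply measurable_angleLine hm, withDensity_apply _ (measurable_angleLine hm),
    Measure.restrict_restrict (measurable_angleLine hm), Set.inter_comm,
    S.qform_lineMeasure hm hb,
    ofReal_integral_eq_lintegral_ofReal (integrableOn_angleWeight _ hm hb)
      (.of_forall angleWeight_nonneg)]
  rfl

theorem integrable_scalar_lineMeasure_iff {f : ℝ → ℝ} (hf : Measurable f) (x : Fin n → ℂ) :
    Integrable f (S.lineMeasure.scalar x) ↔
      IntegrableOn (fun θ => angleWeight θ * f (angleLine θ)) angleOneᶜ
        (S.measure x : Measure ℝ) := by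
  rw [S.scalar_lineMeasure, integrable_map_measure hf.aestronglyMeasurable
    measurable_angleLine.aemeasurable, integrable_withDensity_iff_integrable_smul'
    measurable_angleWeight.ennreal_ofReal (by simp)]
  simp only [ENNReal.toReal_ofReal (angleWeight_nonneg _), smul_eq_mul, Function.comp]
  rfl

theorem integral_scalar_lineMeasure {f : ℝ → ℝ} (hf : Measurable f) (x : Fin n → ℂ) :
    ∫ t, f t ∂(S.lineMeasure.scalar x) =
      ∫ θ in angleOneᶜ, angleWeight θ * f (angleLine θ) ∂(S.measure x : Measure ℝ) := by
  rw [S.scalar_lineMeasure, integral_map measurable_angleLine.aemeasurable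
    hf.aestronglyMeasurable, integral_withDensity_eq_integral_toReal_smul
    measurable_angleWeight.ennreal_ofReal (by simp)]
  simp only [ENNReal.toReal_ofReal (angleWeight_nonneg _), smul_eq_mul]

theorem isClarkMeasure_lineMeasure {F : ℂ → Matrix (Fin n) (Fin n) ℂ}
    (h : ∀ w ∈ upperHalf, ∀ x, qform (nevanlinna F w) x =
      ∫ θ, diskPoisson (cayley w) θ ∂(S.measure x : Measure ℝ)) :
    IsClarkMeasure F S.lineMeasure := by
  have h1 : ∀ x, IntegrableOn (fun _ => (1 : ℝ)) angleOne (S.measure x : Measure ℝ) := fun x =>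
    integrableOn_const
  refine ⟨S.setIntegral (fun _ => 1) angleOne, S.posSemidef_setIntegral measurableSet_angleOne h1
    fun _ => zero_le_one, fun x => ⟨?_, fun w hw => ?_⟩⟩
  · rw [S.integrable_scalar_lineMeasure_iff (by fun_prop)]
    -- The weight cancels `(1 + t²)⁻¹`, leaving the constant `π` against a finite measure.
    refine (integrableOn_const (C := Real.pi)).congr_fun (fun θ _ => ?_)
      measurableSet_angleOne.compl
    have : (1 : ℝ) + angleLine θ ^ 2 ≠ 0 := by positivity
    simp only [angleWeight]
    field_simp
  · simp only [linePoisson_eq_re]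
    have hw' : 0 < w.im := hw
    have hm : Measurable fun t => linePoisson w.im (t - w.re) :=
      ((continuous_linePoisson hw').comp (continuous_sub_right w.re)).measurable
    rw [S.integral_scalar_lineMeasure hm,
      S.qform_setIntegral measurableSet_angleOne h1, h w hw,
      ← integral_add_compl measurableSet_angleOne (integrable_diskPoisson _ (cayley_mem hw)),
      ← integral_mul_const]
    congr 1
    · refine setIntegral_congr_fun measurableSet_angleOne fun θ hθ => ?_
      simp only [one_mul]
      exact diskPoisson_cayley_of_mem hw hθ
    · exact setIntegral_congr_fun measurableSet_angleOne.compl fun θ hθ =>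
        diskPoisson_cayley_of_notMem hw hθ

end QuadraticFamily

/-! ### Existence of the Clark measure. -/

/-- **Matrix Nevanlinna representation.** -/
theorem exists_isClarkMeasure {n : ℕ} {F : ℂ → Matrix (Fin n) (Fin n) ℂ}
    (hF : IsSchur upperHalf F) (hu : ∀ w ∈ upperHalf, IsUnit (1 - F w)) :
    ∃ μ, IsClarkMeasure F μ := by
  let G : (Fin n → ℂ) → ℂ → ℂ := fun x z => star x ⬝ᵥ (nevanlinna F (cayleyInv z) *ᵥ x)
  have hG : ∀ x, DifferentiableOn ℂ (G x) (Metric.ball 0 1) := fun x =>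
    (differentiableOn_dotProduct_mulVec (differentiableOn_nevanlinna hF.analytic hu) x).comp
      differentiableOn_cayleyInv fun _ => cayleyInv_mem
  have hpos : ∀ x, ∀ z ∈ Metric.ball (0 : ℂ) 1, 0 ≤ (G x z).re := fun x z hz =>
    qform_nevanlinna_nonneg (hF.contractive _ (cayleyInv_mem hz)) (hu _ (cayleyInv_mem hz)) x
  choose σ hσ using fun x => exists_boundary_measure (hG x) (hpos x)
  obtain ⟨ι, _, v, N, hN, hv⟩ := exists_qform_dual n
  refine ⟨_, (QuadraticFamily.mk σ ι v N hN fun f x => ?_).isClarkMeasure_lineMeasure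
    fun w hw x => ?_⟩
  -- The polarization identity holds at each radius, and all limits run along the same ultrafilter,
  -- so it passes to the boundary measures.
  · refine tendsto_nhds_unique (hσ x f) ?_
    refine (tendsto_finsetSum _ fun i _ => (hσ (v i) f).const_mul (qform (N i) x)).congr' ?_
    filter_upwards [eventually_radial] with r hr
    simp only [← integral_const_mul]
    rw [← integral_finsetSum]
    · refine integral_congr_ae (.of_forall fun θ => ?_)
      have h : (G x (circleMap 0 r θ)).re =
          ∑ i, (G (v i) (circleMap 0 r θ)).re * qform (N i) x := hv _ x
      simp only [h, Finset.mul_sum]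
      exact Finset.sum_congr rfl fun i _ => by ring
    · intro i _
      refine Integrable.const_mul ?_ _
      refine (Continuous.integrableOn_Icc ?_).mono_set Set.Ioc_subset_Icc_self
      exact f.continuous.mul (continuous_const.mul
        (Complex.continuous_re.comp (continuous_comp_circleMap (hG (v i)) hr)))
  · have h := re_eq_integral_diskPoisson (hG x) (hσ x) (cayley_mem hw)
    rw [← h]
    simp only [G, cayleyInv_cayley hw]
    rfl

/-! ### Unitary conjugation and the theorem. -/

theorem qform_conj {n : ℕ} (R M : Matrix (Fin n) (Fin n) ℂ) (x : Fin n → ℂ) :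
    qform (Rᴴ * M * R) x = qform M (R *ᵥ x) := by
  rw [qform, qform, Matrix.mul_assoc, ← Matrix.mulVec_mulVec, ← Matrix.mulVec_mulVec,
    Matrix.dotProduct_mulVec, Matrix.star_mulVec]

/-- Conjugation of a matrix-valued measure by a constant matrix. -/
def MatrixMeasure.conj {n : ℕ} (μ : MatrixMeasure n) (R : Matrix (Fin n) (Fin n) ℂ) :
    MatrixMeasure n where
  toFun Ω := Rᴴ * μ Ω * R
  posSemidef' Ω hm hb := (μ.posSemidef' Ω hm hb).conjTranspose_mul_mul_same R
  hasSum' f hm hd hb := (μ.hasSum' f hm hd hb).map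
    (AddMonoidHom.mk' (fun M : Matrix (Fin n) (Fin n) ℂ => Rᴴ * M * R)
      fun A B => by rw [Matrix.mul_add, Matrix.add_mul])
    (show Continuous fun M : Matrix (Fin n) (Fin n) ℂ => Rᴴ * M * R by fun_prop)
  eq_zero' Ω hΩ := by rw [μ.eq_zero' Ω hΩ, Matrix.mul_zero, Matrix.zero_mul]

theorem MatrixMeasure.scalar_conj {n : ℕ} (μ : MatrixMeasure n) (R : Matrix (Fin n) (Fin n) ℂ)
    (x : Fin n → ℂ) : (μ.conj R).scalar x = μ.scalar (R *ᵥ x) :=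
  MatrixMeasure.eq_scalar fun Ω hm hb => by
    rw [μ.scalar_apply _ hm hb]
    exact congrArg _ (qform_conj R (μ Ω) x).symm

theorem nevanlinna_conj {n : ℕ} {F G : ℂ → Matrix (Fin n) (Fin n) ℂ}
    {R : Matrix (Fin n) (Fin n) ℂ} (hR : R ∈ Matrix.unitaryGroup (Fin n) ℂ) {w : ℂ}
    (hG : G w = Rᴴ * F w * R) : nevanlinna G w = Rᴴ * nevanlinna F w * R := by
  have h1 : Rᴴ * R = 1 := Matrix.mem_unitaryGroup_iff'.1 hR
  have h2 : R * Rᴴ = 1 := Matrix.mem_unitaryGroup_iff.1 hR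
  have h3 : (1 - G w) = Rᴴ * (1 - F w) * R := by
    rw [hG, Matrix.mul_sub, Matrix.sub_mul, Matrix.mul_one, h1]
  have h4 : (1 + G w) = Rᴴ * (1 + F w) * R := by
    rw [hG, Matrix.mul_add, Matrix.add_mul, Matrix.mul_one, h1]
  have h5 : R⁻¹ = Rᴴ := Matrix.inv_eq_left_inv h1
  have h6 : (Rᴴ)⁻¹ = R := Matrix.inv_eq_left_inv h2
  rw [nevanlinna, nevanlinna, h3, h4, Matrix.mul_inv_rev, Matrix.mul_inv_rev, h5, h6]
  simp only [Matrix.mul_assoc]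
  rw [← Matrix.mul_assoc R Rᴴ, h2, Matrix.one_mul]

/-- On quadratic forms, conjugation by `R` replaces `x` by `R x`, so the representation of `G` at
`x` is that of `F` at `R x`. -/
theorem IsClarkMeasure.conj {n : ℕ} {F G : ℂ → Matrix (Fin n) (Fin n) ℂ}
    {R : Matrix (Fin n) (Fin n) ℂ} (hR : R ∈ Matrix.unitaryGroup (Fin n) ℂ)
    (hG : ∀ w ∈ upperHalf, G w = Rᴴ * F w * R) {μ : MatrixMeasure n} (hμ : IsClarkMeasure F μ) :
    IsClarkMeasure G (μ.conj R) := by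
  obtain ⟨c, hc, h⟩ := hμ
  refine ⟨Rᴴ * c * R, hc.conjTranspose_mul_mul_same R, fun x => ?_⟩
  rw [μ.scalar_conj]
  refine ⟨(h _).1, fun w hw => ?_⟩
  rw [nevanlinna_conj hR (hG w hw), qform_conj, qform_conj]
  exact (h _).2 w hw

theorem IsClarkMeasure.clarkMeasure_eq {n : ℕ} {F : ℂ → Matrix (Fin n) (Fin n) ℂ}
    {μ : MatrixMeasure n} (hμ : IsClarkMeasure F μ) : clarkMeasure F = μ := by
  have h : ∃ μ, IsClarkMeasure F μ := ⟨μ, hμ⟩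
  rw [clarkMeasure, dif_pos h]
  exact h.choose_spec.unique hμ

theorem IsSchur.mul_unitary {n : ℕ} {X : Set ℂ} {B : ℂ → Matrix (Fin n) (Fin n) ℂ}
    (hB : IsSchur X B) {U : Matrix (Fin n) (Fin n) ℂ} (hU : U ∈ Matrix.unitaryGroup (Fin n) ℂ) :
    IsSchur X fun w => B w * U := by
  refine ⟨differentiableOn_matrix_mul_apply hB.analytic fun i j => by fun_prop, fun w hw => ?_⟩
  have h : ‖Matrix.toEuclideanCLM (𝕜 := ℂ) U‖ ≤ 1 := by
    have h := CStarRing.norm_star_mul_self (x := Matrix.toEuclideanCLM (𝕜 := ℂ) U)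
    rw [← map_star, ← map_mul, Matrix.star_eq_conjTranspose,
      show Uᴴ * U = 1 from Matrix.mem_unitaryGroup_iff'.1 hU, map_one] at h
    -- Only an inequality: for `n = 0` the identity has norm `0`.
    have h1 : ‖(1 : EuclideanSpace ℂ (Fin n) →L[ℂ] EuclideanSpace ℂ (Fin n))‖ ≤ 1 :=
      ContinuousLinearMap.norm_id_le
    nlinarith [norm_nonneg (Matrix.toEuclideanCLM (𝕜 := ℂ) U)]
  rw [map_mul]
  exact (norm_mul_le _ _).trans (mul_le_one₀ (hB.contractive w hw) (norm_nonneg _) h)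

end

theorem mainTheorem6 (n : ℕ) (B₁ B₂ : ℂ → Matrix (Fin n) (Fin n) ℂ)
    (hB₁ : IsSchur upperHalf B₁) (hB₂ : IsSchur upperHalf B₂)
    (R Q α : Matrix (Fin n) (Fin n) ℂ)
    (hR : R ∈ Matrix.unitaryGroup (Fin n) ℂ) (hQ : Q ∈ Matrix.unitaryGroup (Fin n) ℂ)
    (hα : α ∈ Matrix.unitaryGroup (Fin n) ℂ)
    (hequiv : ∀ w ∈ upperHalf, B₁ w = R * B₂ w * Q)
    (hinv : ∀ w ∈ upperHalf, IsUnit (1 - B₁ w * αᴴ)) :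
    (∃! μ, IsClarkMeasure (fun w => B₁ w * αᴴ) μ) ∧
    (∃! μ, IsClarkMeasure (fun w => B₂ w * (Q * αᴴ * R)) μ) ∧
    ∀ s : ℝ, clarkMeasure (fun w => B₁ w * αᴴ) {s} =
      R * clarkMeasure (fun w => B₂ w * (Q * αᴴ * R)) {s} * Rᴴ := by
  have hRR : Rᴴ * R = 1 := Matrix.mem_unitaryGroup_iff'.1 hR
  have hRR' : R * Rᴴ = 1 := Matrix.mem_unitaryGroup_iff.1 hR
  obtain ⟨μ, hμ⟩ := exists_isClarkMeasure
    (hB₁.mul_unitary (U := αᴴ) (Unitary.star_mem hα)) hinv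
  -- Existence for the second function comes by conjugation, so invertibility of `1 - B₂ (Q α* R)`
  -- is never checked separately.
  have hν : IsClarkMeasure (fun w => B₂ w * (Q * αᴴ * R)) (μ.conj R) := by
    refine hμ.conj hR fun w hw => ?_
    simp only [hequiv w hw, ← Matrix.mul_assoc, hRR, Matrix.one_mul]
  refine ⟨⟨μ, hμ, fun _ h => h.unique hμ⟩, ⟨_, hν, fun _ h => h.unique hν⟩, fun s => ?_⟩
  rw [hμ.clarkMeasure_eq, hν.clarkMeasure_eq]
  change _ = R * (Rᴴ * μ {s} * R) * Rᴴ
  simp only [← Matrix.mul_assoc, hRR', Matrix.one_mul]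
  rw [Matrix.mul_assoc, hRR', Matrix.mul_one]
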